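/- Let $d\ge 1$, let $\mathbf p^0=(p^0_1,\dots,p^0_d)$ be a probability vector with all $p^0_i>0$, and let $\Delta\in\mathbb R^d$ satisfy $\sum_{i=1}^d\Delta_i=0$. Let $(\rho_n)$ be a sequence of real numbers that are positive for all large $n$. For all sufficiently large $n$ let $X^{(n)}\sim\mathrm{Multinomial}(n,\ \mathbf p^0+\Delta/\sqrt n)$ (the alternative hypothesis; $\mathbf p^0+\Delta/\sqrt n$ is a probability vector for large $n$) and let $Z^{(n)}\sim N(0,\tfrac1{\rho_n}I_d)$ be independent of $X^{(n)}$. Put $$U^{(n)}=\sqrt n\Big(\frac{X^{(n)}+Z^{(n)}}{n}-\mathbf p^0\Big),\qquad \Sigma_r=\mathrm{Diag}(\mathbf p^0)-\mathbf p^0(\mathbf p^0)^\top+\tfrac1r I_d,\qquad P=I_d-\tfrac1d\mathbf 1\mathbf 1^\top,$$ and define the unprojected statistic $Q_n=(U^{(n)})^\top\Sigma_{n\rho_n}^{-1}U^{(n)}$ and the projected statistic $\hat Q_n=(U^{(n)})^\top P\,\Sigma_{n\rho_n}^{-1}P\,U^{(n)}$. Let $\chi^2_k(\lambda)$ denote the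 noncentral chi-square distribution with $k$ degrees of freedom and noncentrality $\lambda$, i.e. the law of $\|Y\|^2$ for $Y\sim N(\delta,I_k)$ with $\|\delta\|^2=\lambda$ (the point mass at $0$ when $k=0$ and $\lambda=0$). (i) If $n\rho_n\to\rho$ with $0<\rho<\infty$, then, as $n\to\infty$, $$Q_n\xrightarrow{D}\chi^2_d\big(\Delta^\top\Sigma_\rho^{-1}\Delta\big)\qquad\text{and}\qquad \hat Q_n\xrightarrow{D}\chi^2_{d-1}\big(\Delta^\top\Sigma_\rho^{-1}\Delta\big).$$ (ii) If $n\rho_n\to\infty$, then, as $n\to\infty$, $$\hat Q_n\xrightarrow{D}\chi^2_{d-1}\Big(\sum_{i=1}^d\frac{\Delta_i^2}{p^0_i}\Big).$$ -/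

import Mathlib

open MeasureTheory ProbabilityTheory Filter
open scoped Matrix

noncomputable section

namespace PrivateChiSquare

/-- The multinomial distribution with `n` trials and cell probabilities `p`: the count vector `x`
with `∑ i, x i = n` has mass `n! / (∏ i, x i !) * ∏ i, p i ^ x i`.
(Meaningful when `p` is a probability vector.) -/
def multinomialMeasure {d : ℕ} (n : ℕ) (p : Fin d → ℝ) : Measure (Fin d → ℕ) :=
  ∑ x ∈ Finset.piAntidiag (Finset.univ : Finset (Fin d)) n,
    ENNReal.ofReal ((Nat.multinomial Finset.univ x : ℝ) * ∏ i, p i ^ x i) • Measure.dirac x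

/-- The noncentral chi-square distribution with `k` degrees of freedom and noncentrality `lam ≥ 0`:
the law of `∑ i, Y i ^ 2` for independent `Y i ~ N(δ i, 1)`, `i < k`, with `∑ i, δ i ^ 2 = lam`.
By rotation invariance only `lam` matters, and we take `δ = (√lam, 0, …, 0)`.
For `k = 0` and `lam = 0` this is the point mass at `0`. -/
def noncentralChiSquare (k : ℕ) (lam : ℝ) : Measure ℝ :=
  (Measure.pi fun i : Fin k ↦ gaussianReal (if (i : ℕ) = 0 then √lam else 0) 1).map
    fun y ↦ ∑ i, y i ^ 2

instance isProbabilityMeasure_noncentralChiSquare (k : ℕ) (lam : ℝ) : IsProbabilityMeasure (noncentralChiSquare k lam) :=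
  Measure.isProbabilityMeasure_map
    (Measurable.aemeasurable (by fun_prop))

variable {d : ℕ}

/-- `p⁰ + Δ / √n`. -/
def localAlternative (p₀ Δ : Fin d → ℝ) (n : ℕ) : Fin d → ℝ :=
  fun i ↦ p₀ i + Δ i / √(n : ℝ)

/-- `Σ = Diag(p⁰) - p⁰ (p⁰)ᵀ`. -/
def covMatrix (p₀ : Fin d → ℝ) : Matrix (Fin d) (Fin d) ℝ :=
  Matrix.diagonal p₀ - Matrix.vecMulVec p₀ p₀

/-- `Σ_r = Σ + (1 / r) I`. -/
def privCovMatrix (p₀ : Fin d → ℝ) (r : ℝ) : Matrix (Fin d) (Fin d) ℝ :=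
  covMatrix p₀ + (1 / r) • (1 : Matrix (Fin d) (Fin d) ℝ)

/-- `P = I - (1 / d) 1 1ᵀ`, the orthogonal projection onto the complement of the all-ones vector. -/
def projMatrix (d : ℕ) : Matrix (Fin d) (Fin d) ℝ :=
  1 - (1 / (d : ℝ)) • Matrix.vecMulVec (fun _ ↦ 1) (fun _ ↦ 1)

/-- `U = √n ((x + z) / n - p⁰)`, for a histogram `x` of `n` data points and a noise vector `z`. -/
def noisyDeviation (p₀ : Fin d → ℝ) (n : ℕ) (x : Fin d → ℕ) (z : EuclideanSpace ℝ (Fin d)) :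
    Fin d → ℝ :=
  fun i ↦ √(n : ℝ) * (((x i : ℝ) + z i) / (n : ℝ) - p₀ i)

/-- The unprojected statistic `Uᵀ Σ_{n r}⁻¹ U` with privacy parameter `r`. -/
def unprojectedStat (p₀ : Fin d → ℝ) (n : ℕ) (r : ℝ) (x : Fin d → ℕ)
    (z : EuclideanSpace ℝ (Fin d)) : ℝ :=
  noisyDeviation p₀ n x z ⬝ᵥ (privCovMatrix p₀ (n * r))⁻¹ *ᵥ noisyDeviation p₀ n x z

/-- The projected statistic `Uᵀ P Σ_{n r}⁻¹ P U` with privacy parameter `r`. -/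
def projectedStat (p₀ : Fin d → ℝ) (n : ℕ) (r : ℝ) (x : Fin d → ℕ)
    (z : EuclideanSpace ℝ (Fin d)) : ℝ :=
  noisyDeviation p₀ n x z ⬝ᵥ
    (projMatrix d * (privCovMatrix p₀ (n * r))⁻¹ * projMatrix d) *ᵥ noisyDeviation p₀ n x z

end PrivateChiSquare

end

noncomputable section

namespace PrivateChiSquare

/-! The vector `U` converges in law to a Gaussian with mean `Δ` and covariance `Σ + s I`, where `s =
lim 1 / (n ρ n)` is `1 / r` in (i) and `0` in (ii). This is Lévy continuity
(`tendsto_law_euclideanDeviation`): the multinomial theorem gives the characteristic function of `U`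
exactly, and a second-order expansion gives its limit.

All three statistics are quadratic forms with matrix `V (Vᵀ Σ_{nρ} V)⁻¹ Vᵀ` for an isometry `V`: the
identity for the unprojected one, an isometry onto the complement of the all-ones vector for the
projected one, since `Σ_r` commutes with `P`. The compression of `Σ + s I` stays invertible even at
`s = 0`, where `Σ` itself is singular, so these matrices converge and Slutsky's argument applies.
`map_quadraticForm_eq_noncentralChiSquare` identifies the limit by whitening, and linear algebra
evaluates the noncentrality. -/

/-! ### Gaussian quadratic forms and the noncentral chi-square law -/

open Complex in
lemma charFun_map_const_add_stdGaussian {E : Type*} [NormedAddCommGroup E] [InnerProductSpace ℝ E]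
    [FiniteDimensional ℝ E] [MeasurableSpace E] [BorelSpace E] (m t : E) :
    charFun ((stdGaussian E).map (m + ·)) t = exp (inner ℝ m t * I - ‖t‖ ^ 2 / 2) := by
  rw [charFun_map_const_add, charFun_stdGaussian, ← exp_add]
  congr 1
  ring

open Complex in
lemma map_toLp_pi_gaussianReal_one {ι : Type*} [Fintype ι] (m : EuclideanSpace ℝ ι) :
    (Measure.pi fun i ↦ gaussianReal (m i) 1).map (WithLp.toLp 2) =
      (stdGaussian (EuclideanSpace ℝ ι)).map (m + ·) := by
  have : IsProbabilityMeasure ((Measure.pi fun i ↦ gaussianReal (m i) 1).map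
      (WithLp.toLp 2 : (ι → ℝ) → EuclideanSpace ℝ ι)) :=
    Measure.isProbabilityMeasure_map (by fun_prop)
  have : IsProbabilityMeasure ((stdGaussian (EuclideanSpace ℝ ι)).map (m + ·)) :=
    Measure.isProbabilityMeasure_map (by fun_prop)
  apply Measure.ext_of_charFun (E := EuclideanSpace ℝ ι)
  ext t
  rw [charFun_map_const_add_stdGaussian, charFun_pi]
  simp_rw [charFun_gaussianReal]
  rw [← exp_sum, ← ofReal_pow, EuclideanSpace.real_norm_sq_eq, PiLp.inner_apply]
  congr 1
  simp [Finset.sum_sub_distrib, Finset.sum_mul, Finset.sum_div]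

/-- Rotation invariance of the noncentral chi-square distribution. -/
lemma map_norm_add_sq_stdGaussian {k : ℕ} (m : EuclideanSpace ℝ (Fin k)) :
    (stdGaussian (EuclideanSpace ℝ (Fin k))).map (fun y ↦ ‖m + y‖ ^ 2) =
      noncentralChiSquare k (‖m‖ ^ 2) := by
  set e : EuclideanSpace ℝ (Fin k) :=
    WithLp.toLp 2 fun i ↦ if (i : ℕ) = 0 then √(‖m‖ ^ 2) else 0 with he
  have hnorm : ‖m‖ = ‖e‖ := by
    cases k with
    | zero => simp [Subsingleton.elim m e]
    | succ k =>
      rw [EuclideanSpace.norm_eq e, Fin.sum_univ_succ]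
      simp [he]
  have hmeas : Measurable fun y : EuclideanSpace ℝ (Fin k) ↦ ‖y‖ ^ 2 := by fun_prop
  have h1 : noncentralChiSquare k (‖m‖ ^ 2) =
      ((stdGaussian (EuclideanSpace ℝ (Fin k))).map (e + ·)).map fun y ↦ ‖y‖ ^ 2 := by
    rw [← map_toLp_pi_gaussianReal_one, Measure.map_map hmeas (by fun_prop), noncentralChiSquare]
    congr 1
    ext y
    simp [EuclideanSpace.real_norm_sq_eq]
  rw [h1, Measure.map_map hmeas (by fun_prop)]
  -- As `m` and `e` have equal norms, this reflection carries `m` to `e`; being an isometry, it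
  -- preserves the standard Gaussian.
  set f := (ℝ ∙ (m - e))ᗮ.reflection
  have hf : f m = e := Submodule.reflection_sub hnorm
  conv_rhs => rw [← stdGaussian_map f, Measure.map_map (by fun_prop) (by fun_prop)]
  congr 1
  ext y
  simp [← hf, ← map_add]

open scoped MatrixOrder Matrix.Norms.L2Operator in
lemma exists_eq_transpose_mul_self {ι : Type*} [Fintype ι] [DecidableEq ι] {A : Matrix ι ι ℝ}
    (hA : A.PosSemidef) : ∃ B : Matrix ι ι ℝ, A = Bᵀ * B := by
  obtain ⟨B, hB⟩ := CStarAlgebra.nonneg_iff_eq_star_mul_self.mp hA.nonneg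
  exact ⟨B, hB⟩

/-- If `y` is Gaussian with mean `m` and covariance `S`, the quadratic form of `Vᵀ y` given by the
inverse of its covariance matrix is noncentral chi-square. -/
lemma map_quadraticForm_eq_noncentralChiSquare {ι : Type*} [Fintype ι] [DecidableEq ι] {k : ℕ}
    (ν : Measure (EuclideanSpace ℝ ι)) [IsProbabilityMeasure ν] (m : EuclideanSpace ℝ ι)
    (S : Matrix ι ι ℝ) (V : Matrix ι (Fin k) ℝ) (hD : (Vᵀ * S * V).PosDef)
    (hν : ∀ t, charFun ν t = Complex.exp (inner ℝ m t * Complex.I - ((t ⬝ᵥ S *ᵥ t : ℝ) : ℂ) / 2)) :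
    ν.map (fun y : EuclideanSpace ℝ ι ↦ y ⬝ᵥ (V * (Vᵀ * S * V)⁻¹ * Vᵀ) *ᵥ y) =
      noncentralChiSquare k (m ⬝ᵥ (V * (Vᵀ * S * V)⁻¹ * Vᵀ) *ᵥ m) := by
  -- `B` whitens: `Bᵀ B` is the inverse covariance of `Vᵀ y`, so `B Vᵀ y` has identity covariance
  -- and the form is its squared norm.
  obtain ⟨B, hB⟩ := exists_eq_transpose_mul_self hD.inv.posSemidef
  have hdet : IsUnit (Vᵀ * S * V).det := (Matrix.isUnit_iff_isUnit_det _).1 hD.isUnit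
  have hBD : B * (Vᵀ * S * V) * Bᵀ = 1 := by
    rw [mul_eq_one_comm, ← Matrix.mul_assoc, ← hB, Matrix.nonsing_inv_mul _ hdet]
  let L : EuclideanSpace ℝ ι →L[ℝ] EuclideanSpace ℝ (Fin k) :=
    (Matrix.toLpLin 2 2 (B * Vᵀ)).toContinuousLinearMap
  have hL (y : EuclideanSpace ℝ ι) : L y = WithLp.toLp 2 (B *ᵥ Vᵀ *ᵥ y) := by
    simp [L, Matrix.toLpLin_apply]
  have hq (y : EuclideanSpace ℝ ι) :
      y ⬝ᵥ (V * (Vᵀ * S * V)⁻¹ * Vᵀ) *ᵥ y = ‖L y‖ ^ 2 := by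
    have : V * (Vᵀ * S * V)⁻¹ * Vᵀ = (B * Vᵀ)ᵀ * (B * Vᵀ) := by
      rw [hB, Matrix.transpose_mul, Matrix.transpose_transpose]
      simp only [Matrix.mul_assoc]
    rw [this, ← Matrix.mulVec_mulVec, Matrix.dotProduct_mulVec, Matrix.vecMul_transpose,
      EuclideanSpace.real_norm_sq_eq, hL]
    simp [dotProduct, sq]
  have hmap : ν.map L = (stdGaussian (EuclideanSpace ℝ (Fin k))).map (L m + ·) := by
    have : IsProbabilityMeasure (ν.map L) := Measure.isProbabilityMeasure_map (by fun_prop)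
    have : IsProbabilityMeasure ((stdGaussian (EuclideanSpace ℝ (Fin k))).map (L m + ·)) :=
      Measure.isProbabilityMeasure_map (by fun_prop)
    apply Measure.ext_of_charFun
    ext t
    have hinner (y : EuclideanSpace ℝ ι) :
        inner ℝ (L y) t = inner ℝ y (WithLp.toLp 2 (V *ᵥ Bᵀ *ᵥ t)) := by
      rw [hL, EuclideanSpace.inner_eq_star_dotProduct, EuclideanSpace.inner_eq_star_dotProduct]
      simp only [star_trivial]
      rw [Matrix.mulVec_mulVec, Matrix.dotProduct_mulVec, Matrix.mulVec_mulVec,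
        ← Matrix.mulVec_transpose]
      simp
    have hchar : charFun (ν.map L) t = charFun ν (WithLp.toLp 2 (V *ᵥ Bᵀ *ᵥ t)) := by
      rw [charFun_apply, integral_map (by fun_prop) (by fun_prop), charFun_apply]
      simp_rw [hinner]
    rw [charFun_map_const_add_stdGaussian, hchar, hν, hinner]
    congr 3
    have : (V *ᵥ Bᵀ *ᵥ t) ⬝ᵥ S *ᵥ (V *ᵥ Bᵀ *ᵥ t) = ‖t‖ ^ 2 := by
      have h2 : (V *ᵥ Bᵀ *ᵥ t) ⬝ᵥ S *ᵥ (V *ᵥ Bᵀ *ᵥ t) =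
          t ⬝ᵥ (B * (Vᵀ * S * V) * Bᵀ) *ᵥ t := by
        have h3 : B * (Vᵀ * S * V) * Bᵀ = (V * Bᵀ)ᵀ * (S * (V * Bᵀ)) := by
          simp [Matrix.mul_assoc]
        rw [h3, ← Matrix.mulVec_mulVec, Matrix.dotProduct_mulVec t, Matrix.vecMul_transpose]
        simp only [Matrix.mulVec_mulVec]
      rw [h2, hBD, Matrix.one_mulVec, EuclideanSpace.real_norm_sq_eq]
      simp [dotProduct, sq]
    change (((V *ᵥ Bᵀ *ᵥ t) ⬝ᵥ S *ᵥ (V *ᵥ Bᵀ *ᵥ t) : ℝ) : ℂ) = _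
    rw [this, Complex.ofReal_pow]
  simp_rw [hq]
  rw [← map_norm_add_sq_stdGaussian]
  have : (fun y ↦ ‖L y‖ ^ 2) = (fun z : EuclideanSpace ℝ (Fin k) ↦ ‖z‖ ^ 2) ∘ L := rfl
  rw [this, ← Measure.map_map (by fun_prop) (by fun_prop), hmap,
    Measure.map_map (by fun_prop) (by fun_prop)]
  rfl

/-! ### Weak convergence of quadratic forms with converging matrices -/

lemma measurable_quadraticForm {ι : Type*} [Fintype ι] (M : Matrix ι ι ℝ) :
    Measurable fun y : EuclideanSpace ℝ ι ↦ y ⬝ᵥ M *ᵥ y := by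
  simp only [dotProduct, Matrix.mulVec]
  fun_prop

/-- Slutsky: pairing with the Dirac mass at `M n` gives weakly convergent product laws, and the form
is jointly continuous in vector and matrix. -/
lemma tendsto_map_quadraticForm {ι : Type*} [Fintype ι]
    {P : ℕ → ProbabilityMeasure (EuclideanSpace ℝ ι)} {P' : ProbabilityMeasure (EuclideanSpace ℝ ι)}
    (hP : Tendsto P atTop (nhds P')) {M : ℕ → ι → ι → ℝ} {M' : ι → ι → ℝ}
    (hM : Tendsto M atTop (nhds M')) :
    Tendsto (β := ProbabilityMeasure ℝ)
      (fun n ↦ (P n).map (measurable_quadraticForm (Matrix.of (M n))).aemeasurable) atTop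
      (nhds (P'.map (measurable_quadraticForm (Matrix.of M')).aemeasurable)) := by
  let g : EuclideanSpace ℝ ι × (ι → ι → ℝ) → ℝ := fun z ↦ z.1 ⬝ᵥ (Matrix.of z.2) *ᵥ z.1
  have hg : Continuous g := by
    simp only [g, dotProduct, Matrix.mulVec, Matrix.of_apply]
    fun_prop
  have hprod := (ProbabilityMeasure.continuous_prod (α := EuclideanSpace ℝ ι)
    (β := ι → ι → ℝ)).tendsto (P', diracProba M')
  have hpair := hP.prodMk_nhds ((continuous_diracProba (X := ι → ι → ℝ)).tendsto M' |>.comp hM)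
  have key := ProbabilityMeasure.tendsto_map_of_tendsto_of_continuous _ _ (hprod.comp hpair) hg
  have heq (Q : ProbabilityMeasure (EuclideanSpace ℝ ι)) (A : ι → ι → ℝ) :
      (Q.prod (diracProba A)).map hg.measurable.aemeasurable =
        Q.map (measurable_quadraticForm (Matrix.of A)).aemeasurable := by
    apply Subtype.ext
    change ((Q : Measure (EuclideanSpace ℝ ι)).prod (Measure.dirac A)).map g =
      (Q : Measure (EuclideanSpace ℝ ι)).map _
    rw [Measure.prod_dirac, Measure.map_map hg.measurable (by fun_prop)]
    rfl
  simpa only [heq, Function.comp_def] using key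

/-! ### Multinomial characteristic function and its local limit -/

open Complex in
-- This is the multinomial theorem. Nonnegativity of `p` only ensures that `ENNReal.ofReal` does not
-- truncate the masses.
lemma integral_exp_multinomialMeasure {d : ℕ} (n : ℕ) {p : Fin d → ℝ} (hp : ∀ i, 0 ≤ p i)
    (a : Fin d → ℝ) :
    ∫ x, exp (∑ i, ((x i : ℝ) * a i : ℝ) * I) ∂(multinomialMeasure n p) =
      (∑ i, p i * exp (a i * I)) ^ n := by
  rw [multinomialMeasure, integral_finsetSum_measure, Finset.sum_pow_eq_sum_piAntidiag]
  · refine Finset.sum_congr rfl fun x _ ↦ ?_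
    rw [integral_smul_measure, integral_dirac, ENNReal.toReal_ofReal
      (mul_nonneg (by positivity) (Finset.prod_nonneg fun i _ ↦ pow_nonneg (hp i) _))]
    rw [exp_sum, real_smul]
    push_cast
    rw [mul_assoc, ← Finset.prod_mul_distrib]
    congr 1
    refine Finset.prod_congr rfl fun i _ ↦ ?_
    rw [mul_pow, ← exp_nat_mul, mul_assoc]
  · intro x _
    exact (integrable_dirac (by simp)).smul_measure ENNReal.ofReal_ne_top

open Complex in
lemma tendsto_nat_mul_exp_sub_one_sub (a : ℝ) :
    Tendsto (fun n : ℕ ↦ (n : ℂ) * (exp ((a / √n : ℝ) * I) - 1 - (a / √n : ℝ) * I)) atTop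
      (nhds (-a ^ 2 / 2)) := by
  rw [tendsto_iff_norm_sub_tendsto_zero]
  have hlim : Tendsto (fun n : ℕ ↦ |a| ^ 3 * Real.exp |a| * (√(n : ℝ))⁻¹) atTop (nhds 0) := by
    rw [← mul_zero (|a| ^ 3 * Real.exp |a|)]
    exact (tendsto_inv_atTop_zero.comp
      (Real.tendsto_sqrt_atTop.comp tendsto_natCast_atTop_atTop)).const_mul _
  refine squeeze_zero' (.of_forall fun _ ↦ norm_nonneg _) ?_ hlim
  filter_upwards [eventually_ge_atTop 1] with n hn
  have hn0 : (0 : ℝ) < n := by exact_mod_cast hn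
  have hs : 0 < √(n : ℝ) := Real.sqrt_pos.2 hn0
  have hs1 : 1 ≤ √(n : ℝ) := Real.one_le_sqrt.2 (by exact_mod_cast hn)
  have hsq : √(n : ℝ) ^ 2 = n := Real.sq_sqrt hn0.le
  set z : ℂ := (a / √n : ℝ) * I with hz
  have hnz : (n : ℂ) * z ^ 2 = -a ^ 2 := by
    have : (n : ℝ) * (a / √n) ^ 2 = a ^ 2 := by
      rw [div_pow, hsq]
      field_simp
    rw [hz, mul_pow, I_sq, ← mul_assoc, mul_neg_one, ← ofReal_natCast,
      ← ofReal_pow, ← ofReal_mul, this, ofReal_pow]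
  have hzn : ‖z‖ = |a| / √n := by
    rw [hz, norm_mul, norm_I, mul_one, norm_real, Real.norm_eq_abs, abs_div, abs_of_pos hs]
  have hza : ‖z‖ ≤ |a| := by
    rw [hzn]
    exact div_le_self (abs_nonneg a) hs1
  -- The cubic remainder is of order `n^(-3/2)`, hence vanishes after multiplication by `n`.
  have hbound := norm_exp_sub_sum_le_norm_mul_exp z 3
  have heq : (n : ℂ) * (exp z - 1 - z) - -a ^ 2 / 2 =
      n * (exp z - ∑ m ∈ Finset.range 3, z ^ m / m.factorial) := by
    rw [← hnz]
    simp [Finset.sum_range_succ, Nat.factorial]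
    ring
  rw [heq, norm_mul, Complex.norm_natCast]
  calc (n : ℝ) * ‖exp z - ∑ m ∈ Finset.range 3, z ^ m / m.factorial‖
      ≤ n * (‖z‖ ^ 3 * Real.exp ‖z‖) := by gcongr
    _ ≤ n * (‖z‖ ^ 3 * Real.exp |a|) := by gcongr
    _ = |a| ^ 3 * Real.exp |a| * (√n)⁻¹ := by
        have h (s : ℝ) (hs : 0 < s) :
            s ^ 2 * ((|a| / s) ^ 3 * Real.exp |a|) = |a| ^ 3 * Real.exp |a| * s⁻¹ := by
          field_simp
        rw [hzn, ← h _ hs, hsq]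

open Complex in
-- The sum is `1 + g n` with `n * g n` convergent, so its `n`-th power tends to an exponential.
-- Centring `a` under `p₀` kills a linear term of size `√n`; the perturbation `Δ / √n` leaves the
-- drift `∑ Δ i * a i`.
lemma tendsto_sum_localAlternative_mul_exp_pow {d : ℕ} {p₀ Δ a : Fin d → ℝ}
    (hp₀_sum : ∑ i, p₀ i = 1) (hΔ : ∑ i, Δ i = 0) (ha : ∑ i, p₀ i * a i = 0) :
    Tendsto (fun n : ℕ ↦
      (∑ i, (localAlternative p₀ Δ n i : ℂ) * exp ((a i / √n : ℝ) * I)) ^ n) atTop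
      (nhds (exp ((∑ i, Δ i * a i : ℝ) * I - (∑ i, p₀ i * a i ^ 2 : ℝ) / 2))) := by
  have hsum (n : ℕ) : ∑ i, (localAlternative p₀ Δ n i : ℂ) = 1 := by
    rw [← ofReal_sum]
    simp [localAlternative, Finset.sum_add_distrib, ← Finset.sum_div, hp₀_sum, hΔ]
  have hg (n : ℕ) : ∑ i, (localAlternative p₀ Δ n i : ℂ) * exp ((a i / √n : ℝ) * I) =
      1 + ∑ i, (localAlternative p₀ Δ n i : ℂ) * (exp ((a i / √n : ℝ) * I) - 1) := by
    simp [mul_sub, hsum]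
  simp_rw [hg]
  apply tendsto_one_add_pow_exp_of_tendsto
  have hp (i : Fin d) : Tendsto (fun n : ℕ ↦ (localAlternative p₀ Δ n i : ℂ)) atTop
      (nhds (p₀ i)) := by
    apply (continuous_ofReal.tendsto _).comp
    have : Tendsto (fun n : ℕ ↦ Δ i / √(n : ℝ)) atTop (nhds 0) :=
      tendsto_const_nhds.div_atTop (Real.tendsto_sqrt_atTop.comp tendsto_natCast_atTop_atTop)
    simpa [localAlternative] using this.const_add (p₀ i)
  have hlim : Tendsto (fun n : ℕ ↦ (∑ i, Δ i * a i : ℝ) * I +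
      ∑ i, (localAlternative p₀ Δ n i : ℂ) *
        ((n : ℂ) * (exp ((a i / √n : ℝ) * I) - 1 - (a i / √n : ℝ) * I))) atTop
      (nhds ((∑ i, Δ i * a i : ℝ) * I + ∑ i, (p₀ i : ℂ) * (-a i ^ 2 / 2))) :=
    (tendsto_finsetSum _ fun i _ ↦
      (hp i).mul (tendsto_nat_mul_exp_sub_one_sub (a i))).const_add _
  have hval : (∑ i, Δ i * a i : ℝ) * I + ∑ i, (p₀ i : ℂ) * (-a i ^ 2 / 2) =
      (∑ i, Δ i * a i : ℝ) * I - (∑ i, p₀ i * a i ^ 2 : ℝ) / 2 := by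
    push_cast
    rw [sub_eq_add_neg, ← neg_div, ← Finset.sum_neg_distrib, Finset.sum_div]
    congr 1
    exact Finset.sum_congr rfl fun i _ ↦ by ring
  rw [← hval]
  refine hlim.congr' ?_
  filter_upwards [eventually_ge_atTop 1] with n hn
  have hn0 : (0 : ℝ) < n := by exact_mod_cast hn
  have hs : 0 < √(n : ℝ) := Real.sqrt_pos.2 hn0
  have hsq : √(n : ℝ) ^ 2 = n := Real.sq_sqrt hn0.le
  have hlin : ∑ i, Δ i * a i = ∑ i, localAlternative p₀ Δ n i * (n * (a i / √n)) := by
    have h (i : Fin d) : localAlternative p₀ Δ n i * (n * (a i / √n)) =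
        √n * (p₀ i * a i) + Δ i * a i := by
      have h' (s : ℝ) (hs : 0 < s) :
          (p₀ i + Δ i / s) * (s ^ 2 * (a i / s)) = s * (p₀ i * a i) + Δ i * a i := by
        field_simp
      rw [localAlternative, ← h' _ hs, hsq]
    simp_rw [h]
    rw [Finset.sum_add_distrib, ← Finset.mul_sum, ha, mul_zero, zero_add]
  rw [hlin]
  push_cast
  rw [Finset.sum_mul, ← Finset.sum_add_distrib, Finset.mul_sum]
  exact Finset.sum_congr rfl fun i _ ↦ by ring

/-! ### Exact characteristic function of the noisy deviation -/

/-- `noisyDeviation` as a vector of the Euclidean space. -/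
def euclideanDeviation {d : ℕ} (p₀ : Fin d → ℝ) (n : ℕ) (x : Fin d → ℕ)
    (z : EuclideanSpace ℝ (Fin d)) : EuclideanSpace ℝ (Fin d) :=
  WithLp.toLp 2 (noisyDeviation p₀ n x z)

lemma measurable_euclideanDeviation {d : ℕ} (p₀ : Fin d → ℝ) (n : ℕ) :
    Measurable fun z : (Fin d → ℕ) × EuclideanSpace ℝ (Fin d) ↦
      euclideanDeviation p₀ n z.1 z.2 := by
  unfold euclideanDeviation noisyDeviation
  fun_prop

lemma aemeasurable_euclideanDeviation {d : ℕ} (p₀ : Fin d → ℝ) (n : ℕ) {Ω : Type*}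
    [MeasurableSpace Ω] {μ : Measure Ω} {X : Ω → Fin d → ℕ} {Z : Ω → EuclideanSpace ℝ (Fin d)}
    (hX : AEMeasurable X μ) (hZ : AEMeasurable Z μ) :
    AEMeasurable (fun ω ↦ euclideanDeviation p₀ n (X ω) (Z ω)) μ := by
  have h := (measurable_euclideanDeviation p₀ n).comp_aemeasurable (hX.prodMk hZ)
  exact h

open Complex in
lemma charFun_multivariateGaussian_smul_one {ι : Type*} [Fintype ι] [DecidableEq ι] {v : ℝ}
    (hv : 0 ≤ v) (t : EuclideanSpace ℝ ι) :
    charFun (multivariateGaussian 0 (v • (1 : Matrix ι ι ℝ))) t =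
      exp (-((v * ∑ i, t i ^ 2 : ℝ) : ℂ) / 2) := by
  have : t.ofLp ⬝ᵥ (v • (1 : Matrix ι ι ℝ)) *ᵥ t.ofLp = v * ∑ i, t i ^ 2 := by
    rw [Matrix.smul_mulVec, Matrix.one_mulVec, dotProduct_smul, dotProduct, smul_eq_mul]
    simp [sq]
  rw [charFun_multivariateGaussian (Matrix.PosSemidef.one.smul hv), this, inner_zero_right,
    ofReal_zero, zero_mul, zero_sub, neg_div]

lemma inner_euclideanDeviation {d : ℕ} (p₀ : Fin d → ℝ) {n : ℕ} (hn : 1 ≤ n) (x : Fin d → ℕ)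
    (z t : EuclideanSpace ℝ (Fin d)) :
    inner ℝ (euclideanDeviation p₀ n x z) t =
      -(√n * ∑ j, p₀ j * t j) + (∑ i, (x i : ℝ) * (t i / √n) + inner ℝ z ((√n)⁻¹ • t)) := by
  have hn0 : (0 : ℝ) < n := by exact_mod_cast hn
  have hs : 0 < √(n : ℝ) := Real.sqrt_pos.2 hn0
  have hsq : √(n : ℝ) ^ 2 = n := Real.sq_sqrt hn0.le
  rw [inner_smul_right, PiLp.inner_apply, PiLp.inner_apply, Finset.mul_sum, Finset.mul_sum,
    ← Finset.sum_neg_distrib, ← Finset.sum_add_distrib, ← Finset.sum_add_distrib]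
  refine Finset.sum_congr rfl fun i _ ↦ ?_
  have h (s x z q u : ℝ) (hs : 0 < s) : u * (s * ((x + z) / s ^ 2 - q)) =
      -(s * (q * u)) + (x * (u / s) + s⁻¹ * (u * z)) := by
    field_simp
    ring
  simpa [euclideanDeviation, noisyDeviation, hsq] using h (√n) (x i) (z i) (p₀ i) (t i) hs

open Complex in
-- The deterministic shift is distributed over the `n` factors. With `m` the `p₀`-mean of `u`, this
-- produces the centred frequencies that the local limit requires.
lemma exp_mul_sum_pow {ι : Type*} [Fintype ι] {n : ℕ} (hn : 1 ≤ n) (q : ι → ℂ) (u : ι → ℝ) (m : ℝ) :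
    exp (-(√n * m : ℝ) * I) * (∑ i, q i * exp ((u i / √n : ℝ) * I)) ^ n =
      (∑ i, q i * exp (((u i - m) / √n : ℝ) * I)) ^ n := by
  have hn0 : (0 : ℝ) < n := by exact_mod_cast hn
  have hexp : exp (-(√n * m : ℝ) * I) = exp (-(m / √n : ℝ) * I) ^ n := by
    rw [← exp_nat_mul]
    congr 1
    have h (s : ℝ) (hs : 0 < s) : s * m = s ^ 2 * (m / s) := by field_simp
    rw [h _ (Real.sqrt_pos.2 hn0), Real.sq_sqrt hn0.le]
    push_cast
    ring
  rw [hexp, ← mul_pow, Finset.mul_sum]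
  congr 1
  refine Finset.sum_congr rfl fun i _ ↦ ?_
  rw [mul_left_comm, ← exp_add, sub_div]
  congr 2
  push_cast
  ring

open Complex in
lemma charFun_map_euclideanDeviation {d : ℕ} {Ω : Type*} [MeasurableSpace Ω] {μ : Measure Ω}
    [IsProbabilityMeasure μ] {n : ℕ} (hn : 1 ≤ n) {p₀ p : Fin d → ℝ} (hp : ∀ i, 0 ≤ p i)
    {X : Ω → Fin d → ℕ} {Z : Ω → EuclideanSpace ℝ (Fin d)} (hX : HasLaw X (multinomialMeasure n p) μ)
    {v : ℝ} (hv : 0 ≤ v)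
    (hZ : HasLaw Z (multivariateGaussian 0 (v • (1 : Matrix (Fin d) (Fin d) ℝ))) μ)
    (hXZ : IndepFun X Z μ) (t : EuclideanSpace ℝ (Fin d)) :
    charFun (μ.map fun ω ↦ euclideanDeviation p₀ n (X ω) (Z ω)) t =
      (∑ i, (p i : ℂ) * exp (((t i - ∑ j, p₀ j * t j) / √n : ℝ) * I)) ^ n *
        exp (-((v / n * ∑ i, t i ^ 2 : ℝ) : ℂ) / 2) := by
  let f : (Fin d → ℕ) → ℂ := fun x ↦ exp (∑ i, ((x i : ℝ) * (t i / √n) : ℝ) * I)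
  let g : EuclideanSpace ℝ (Fin d) → ℂ := fun z ↦ exp (inner ℝ z ((√n)⁻¹ • t) * I)
  have hdecomp (ω : Ω) : exp (inner ℝ (euclideanDeviation p₀ n (X ω) (Z ω)) t * I) =
      exp (-(√n * ∑ j, p₀ j * t j : ℝ) * I) * (f (X ω) * g (Z ω)) := by
    simp only [f, g]
    rw [← exp_add, ← exp_add, ← Finset.sum_mul, ← ofReal_sum, ← ofReal_neg, ← add_mul, ← add_mul,
      ← ofReal_add, ← ofReal_add, inner_euclideanDeviation p₀ hn]
  have hU := aemeasurable_euclideanDeviation p₀ n hX.aemeasurable hZ.aemeasurable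
  have hf : Measurable f := measurable_of_countable f
  have hg : Measurable g := by fun_prop
  rw [charFun_apply, integral_map hU (Measurable.aestronglyMeasurable (by fun_prop))]
  simp_rw [hdecomp]
  rw [integral_const_mul, hXZ.integral_fun_comp_mul_comp hX.aemeasurable hZ.aemeasurable
    hf.aestronglyMeasurable hg.aestronglyMeasurable, ← mul_assoc]
  have hfX : ∫ ω, f (X ω) ∂μ = (∑ i, p i * exp ((t i / √n : ℝ) * I)) ^ n := by
    rw [← integral_exp_multinomialMeasure n hp, ← hX.map_eq,
      integral_map hX.aemeasurable hf.aestronglyMeasurable]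
  have hgZ : ∫ ω, g (Z ω) ∂μ = exp (-((v / n * ∑ i, t i ^ 2 : ℝ) : ℂ) / 2) := by
    rw [← integral_map hZ.aemeasurable hg.aestronglyMeasurable, hZ.map_eq, ← charFun_apply,
      charFun_multivariateGaussian_smul_one hv]
    congr 4
    simp_rw [PiLp.smul_apply, smul_eq_mul, mul_pow, inv_pow, Real.sq_sqrt n.cast_nonneg]
    rw [← Finset.mul_sum, ← mul_assoc, div_eq_mul_inv]
  rw [hfX, hgZ, exp_mul_sum_pow hn]

/-! ### Linear algebra of the covariance and the projection -/

lemma isHermitian_covMatrix_add_smul {d : ℕ} (p₀ : Fin d → ℝ) (s : ℝ) :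
    (covMatrix p₀ + s • (1 : Matrix (Fin d) (Fin d) ℝ)).IsHermitian := by
  rw [Matrix.IsHermitian, Matrix.conjTranspose_eq_transpose_of_trivial, covMatrix]
  simp [Matrix.transpose_vecMulVec]

/-- The form of `Σ` is the variance of `x` under `p₀`, which makes positivity visible. -/
lemma dotProduct_covMatrix_add_smul_mulVec {d : ℕ} {p₀ : Fin d → ℝ} (hp₀_sum : ∑ i, p₀ i = 1)
    (s : ℝ) (x : Fin d → ℝ) :
    x ⬝ᵥ (covMatrix p₀ + s • (1 : Matrix (Fin d) (Fin d) ℝ)) *ᵥ x =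
      ∑ i, p₀ i * (x i - ∑ j, p₀ j * x j) ^ 2 + s * ∑ i, x i ^ 2 := by
  set m := ∑ j, p₀ j * x j with hm
  have h1 : ∑ i, p₀ i * (x i - m) ^ 2 = ∑ i, p₀ i * x i ^ 2 - m ^ 2 := by
    have h (i : Fin d) : p₀ i * (x i - m) ^ 2 =
        p₀ i * x i ^ 2 - 2 * m * (p₀ i * x i) + m ^ 2 * p₀ i := by ring
    simp_rw [h]
    rw [Finset.sum_add_distrib, Finset.sum_sub_distrib, ← Finset.mul_sum, ← Finset.mul_sum,
      hp₀_sum, ← hm]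
    ring
  rw [h1, covMatrix, Matrix.add_mulVec, Matrix.sub_mulVec, Matrix.smul_mulVec, Matrix.one_mulVec,
    Matrix.vecMulVec_mulVec, dotProduct_add, dotProduct_sub]
  have h2 : x ⬝ᵥ Matrix.diagonal p₀ *ᵥ x = ∑ i, p₀ i * x i ^ 2 :=
    Finset.sum_congr rfl fun i _ ↦ by rw [Matrix.mulVec_diagonal]; ring
  have h3 : p₀ ⬝ᵥ x = m := rfl
  have h4 : x ⬝ᵥ x = ∑ i, x i ^ 2 := Finset.sum_congr rfl fun i _ ↦ by ring
  rw [h2, h3, dotProduct_smul, dotProduct_comm x p₀, h3, dotProduct_smul, h4]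
  simp [sq]

lemma posSemidef_covMatrix_add_smul {d : ℕ} {p₀ : Fin d → ℝ} (hp₀_pos : ∀ i, 0 < p₀ i)
    (hp₀_sum : ∑ i, p₀ i = 1) {s : ℝ} (hs : 0 ≤ s) :
    (covMatrix p₀ + s • (1 : Matrix (Fin d) (Fin d) ℝ)).PosSemidef := by
  refine .of_dotProduct_mulVec_nonneg (isHermitian_covMatrix_add_smul p₀ s) fun x ↦ ?_
  rw [star_trivial, dotProduct_covMatrix_add_smul_mulVec hp₀_sum]
  have := fun i ↦ (hp₀_pos i).le
  exact add_nonneg (Finset.sum_nonneg fun i _ ↦ mul_nonneg (this i) (sq_nonneg _)) (by positivity)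

/-- Compressing `Σ + s I` by an isometry `V` gives a positive definite matrix if `s > 0` or if the
range of `V` is orthogonal to the all-ones vector. -/
lemma posDef_transpose_mul_covMatrix_mul {d k : ℕ} {p₀ : Fin d → ℝ} (hp₀_pos : ∀ i, 0 < p₀ i)
    (hp₀_sum : ∑ i, p₀ i = 1) {s : ℝ} (hs : 0 ≤ s) {V : Matrix (Fin d) (Fin k) ℝ}
    (hV : Vᵀ * V = 1) (hsV : 0 < s ∨ 1 ᵥ* V = 0) :
    (Vᵀ * (covMatrix p₀ + s • (1 : Matrix (Fin d) (Fin d) ℝ)) * V).PosDef := by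
  refine .of_dotProduct_mulVec_pos ?_ fun x hx ↦ ?_
  · simpa [Matrix.conjTranspose_eq_transpose_of_trivial] using
      Matrix.isHermitian_conjTranspose_mul_mul V (isHermitian_covMatrix_add_smul p₀ s)
  set v := V *ᵥ x with hv
  have hvx : Vᵀ *ᵥ v = x := by rw [hv, Matrix.mulVec_mulVec, hV, Matrix.one_mulVec]
  have hq : star x ⬝ᵥ (Vᵀ * (covMatrix p₀ + s • (1 : Matrix (Fin d) (Fin d) ℝ)) * V) *ᵥ x =
      ∑ i, p₀ i * (v i - ∑ j, p₀ j * v j) ^ 2 + s * ∑ i, v i ^ 2 := by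
    rw [← dotProduct_covMatrix_add_smul_mulVec hp₀_sum, star_trivial, Matrix.mul_assoc,
      ← Matrix.mulVec_mulVec, Matrix.dotProduct_mulVec, Matrix.vecMul_transpose,
      ← Matrix.mulVec_mulVec]
  have hv0 : v ≠ 0 := fun h ↦ hx (by rw [← hvx, h, Matrix.mulVec_zero])
  have hn1 (i : Fin d) : 0 ≤ p₀ i * (v i - ∑ j, p₀ j * v j) ^ 2 :=
    mul_nonneg (hp₀_pos i).le (sq_nonneg _)
  have hn2 : 0 ≤ ∑ i, v i ^ 2 := Finset.sum_nonneg fun i _ ↦ sq_nonneg _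
  rw [hq]
  rcases hsV with hs0 | h1V
  · refine add_pos_of_nonneg_of_pos (Finset.sum_nonneg fun i _ ↦ hn1 i) (mul_pos hs0 ?_)
    refine hn2.lt_of_ne' fun h ↦ hv0 ?_
    ext i
    simpa using (Finset.sum_eq_zero_iff_of_nonneg fun i _ ↦ sq_nonneg (v i)).1 h i
  · refine add_pos_of_pos_of_nonneg ?_ (mul_nonneg hs hn2)
    refine (Finset.sum_nonneg fun i _ ↦ hn1 i).lt_of_ne' fun h ↦ hv0 ?_
    set m := ∑ j, p₀ j * v j
    -- Zero variance under full-support weights forces `v` to be constant; orthogonality to the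
    -- all-ones vector then makes it zero.
    have hvm (i : Fin d) : v i = m := by
      have := (Finset.sum_eq_zero_iff_of_nonneg fun i _ ↦ hn1 i).1 h i (Finset.mem_univ i)
      simpa [(hp₀_pos i).ne', sub_eq_zero] using this
    have hsum : ∑ i, v i = 0 := by
      rw [← one_dotProduct, hv, Matrix.dotProduct_mulVec, h1V, zero_dotProduct]
    ext i
    have hd : (d : ℝ) ≠ 0 := by
      have := i.pos
      positivity
    simp_rw [hvm] at hsum
    simpa [hvm, hd] using hsum

/-- An isometry onto the orthogonal complement of the all-ones vector. -/
lemma exists_isometry_mul_transpose_eq_projMatrix (k : ℕ) :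
    ∃ V : Matrix (Fin (k + 1)) (Fin k) ℝ, Vᵀ * V = 1 ∧ V * Vᵀ = projMatrix (k + 1) := by
  let c : ℝ := (√((k + 1 : ℕ) : ℝ))⁻¹
  have hc : c * c = 1 / ((k + 1 : ℕ) : ℝ) := by
    rw [← mul_inv, Real.mul_self_sqrt (Nat.cast_nonneg _), one_div]
  let e : Fin (k + 1) → EuclideanSpace ℝ (Fin (k + 1)) := fun _ ↦ WithLp.toLp 2 fun _ ↦ c
  have he : Orthonormal ℝ (({0} : Set (Fin (k + 1))).domRestrict e) := by
    rw [orthonormal_subsingleton_iff]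
    intro i
    have : ‖e i‖ ^ 2 = 1 := by
      rw [EuclideanSpace.real_norm_sq_eq]
      simp only [e, sq, hc]
      rw [Finset.sum_const, Finset.card_univ, Fintype.card_fin, nsmul_eq_mul]
      field_simp
    exact (pow_eq_one_iff_of_nonneg (norm_nonneg _) two_ne_zero).1 this
  -- The normalised all-ones vector becomes `b 0`; the remaining basis vectors are the columns of
  -- `V`. In `O * Oᵀ = 1` the term of `b 0` is the matrix subtracted in `projMatrix`.
  obtain ⟨b, hb⟩ := he.exists_orthonormalBasis_extension_of_card_eq (by simp)
  have hb0 : b 0 = e 0 := hb 0 rfl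
  have hinner (i j : Fin (k + 1)) : ∑ l, b i l * b j l = if i = j then 1 else 0 := by
    rw [← orthonormal_iff_ite.1 b.orthonormal i j, PiLp.inner_apply]
    exact Finset.sum_congr rfl fun l _ ↦ by simp [mul_comm]
  let O : Matrix (Fin (k + 1)) (Fin (k + 1)) ℝ := Matrix.of fun i j ↦ b j i
  have hO : O * Oᵀ = 1 := by
    rw [mul_eq_one_comm]
    ext i j
    simp [O, Matrix.mul_apply, hinner, Matrix.one_apply]
  refine ⟨Matrix.of fun i j ↦ b j.succ i, ?_, ?_⟩
  · ext i j
    simp [Matrix.mul_apply, hinner, Matrix.one_apply]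
  · ext i j
    have := congrFun (congrFun hO i) j
    simp only [O, Matrix.mul_apply, Matrix.transpose_apply, Matrix.of_apply, Fin.sum_univ_succ,
      hb0, e, hc] at this
    simp only [Matrix.mul_apply, Matrix.transpose_apply, Matrix.of_apply, projMatrix,
      Matrix.sub_apply, Matrix.smul_apply, Matrix.vecMulVec_apply, ← this]
    simp

lemma one_vecMul_eq_zero {k : ℕ} {V : Matrix (Fin (k + 1)) (Fin k) ℝ} (hV : Vᵀ * V = 1)
    (hVP : V * Vᵀ = projMatrix (k + 1)) : 1 ᵥ* V = 0 := by
  have hP : (1 : Fin (k + 1) → ℝ) ᵥ* projMatrix (k + 1) = 0 := by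
    ext i
    simp [projMatrix, Matrix.vecMul_sub, Matrix.vecMul_smul, Matrix.vecMul_vecMulVec]
    field_simp
    simp [dotProduct]
  calc 1 ᵥ* V = 1 ᵥ* (V * Vᵀ) ᵥ* V := by
        rw [Matrix.vecMul_vecMul, Matrix.mul_assoc, hV, Matrix.mul_one]
    _ = 0 := by rw [hVP, hP, Matrix.zero_vecMul]

/-- If `S` commutes with the projection `V Vᵀ`, the compression of `S⁻¹` is the inverse of the
compression of `S`. -/
lemma mul_inv_mul_transpose_eq {ι κ : Type*} [Fintype ι] [DecidableEq ι] [Fintype κ]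
    [DecidableEq κ] {V : Matrix ι κ ℝ} {P S : Matrix ι ι ℝ} (hV : Vᵀ * V = 1) (hVP : V * Vᵀ = P)
    (hS : IsUnit S.det) (hSP : S * P = P * S) :
    V * (Vᵀ * S * V)⁻¹ * Vᵀ = P * S⁻¹ * P := by
  have h : Vᵀ * S⁻¹ * V * (Vᵀ * S * V) = 1 :=
    calc Vᵀ * S⁻¹ * V * (Vᵀ * S * V) = Vᵀ * S⁻¹ * (V * Vᵀ * S) * V := by
          simp only [Matrix.mul_assoc]
      _ = Vᵀ * (S⁻¹ * S) * (V * (Vᵀ * V)) := by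
          rw [hVP, ← hSP, ← hVP]
          simp only [Matrix.mul_assoc]
      _ = 1 := by rw [Matrix.nonsing_inv_mul _ hS, hV, Matrix.mul_one, Matrix.mul_one, hV]
  rw [Matrix.inv_eq_left_inv h, ← hVP]
  simp only [Matrix.mul_assoc]

lemma covMatrix_mulVec_one {d : ℕ} {p₀ : Fin d → ℝ} (hp₀_sum : ∑ i, p₀ i = 1) :
    covMatrix p₀ *ᵥ 1 = 0 := by
  rw [covMatrix, Matrix.sub_mulVec, Matrix.vecMulVec_mulVec, dotProduct_one, hp₀_sum]
  ext i
  simp [Matrix.mulVec_diagonal]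

lemma covMatrix_mul_projMatrix {d : ℕ} {p₀ : Fin d → ℝ} (hp₀_sum : ∑ i, p₀ i = 1) :
    covMatrix p₀ * projMatrix d = covMatrix p₀ := by
  have h : covMatrix p₀ * Matrix.vecMulVec (1 : Fin d → ℝ) (1 : Fin d → ℝ) = 0 := by
    rw [Matrix.mul_vecMulVec, covMatrix_mulVec_one hp₀_sum, Matrix.zero_vecMulVec]
  rw [projMatrix, Matrix.mul_sub, Matrix.mul_one, Matrix.mul_smul]
  change _ - (1 / (d : ℝ)) • (covMatrix p₀ * Matrix.vecMulVec (1 : Fin d → ℝ) (1 : Fin d → ℝ)) = _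
  rw [h, smul_zero, sub_zero]

lemma transpose_projMatrix (d : ℕ) : (projMatrix d)ᵀ = projMatrix d := by
  simp [projMatrix, Matrix.transpose_vecMulVec]

lemma transpose_covMatrix {d : ℕ} (p₀ : Fin d → ℝ) : (covMatrix p₀)ᵀ = covMatrix p₀ := by
  simp [covMatrix, Matrix.transpose_vecMulVec]

lemma projMatrix_mul_covMatrix {d : ℕ} {p₀ : Fin d → ℝ} (hp₀_sum : ∑ i, p₀ i = 1) :
    projMatrix d * covMatrix p₀ = covMatrix p₀ := by
  have := congrArg Matrix.transpose (covMatrix_mul_projMatrix hp₀_sum)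
  rwa [Matrix.transpose_mul, transpose_projMatrix, transpose_covMatrix] at this

lemma projMatrix_mulVec_of_sum_eq_zero {d : ℕ} {Δ : Fin d → ℝ} (hΔ : ∑ i, Δ i = 0) :
    projMatrix d *ᵥ Δ = Δ := by
  have h : (fun _ ↦ 1 : Fin d → ℝ) ⬝ᵥ Δ = 0 := by simpa [dotProduct] using hΔ
  rw [projMatrix, Matrix.sub_mulVec, Matrix.one_mulVec, Matrix.smul_mulVec,
    Matrix.vecMulVec_mulVec, h]
  simp

/-- Since `P` fixes `Δ`, projecting does not change the noncentrality. -/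
lemma dotProduct_mul_mul_projMatrix {d : ℕ} {Δ : Fin d → ℝ} (hΔ : ∑ i, Δ i = 0)
    (A : Matrix (Fin d) (Fin d) ℝ) :
    Δ ⬝ᵥ (projMatrix d * A * projMatrix d) *ᵥ Δ = Δ ⬝ᵥ A *ᵥ Δ := by
  rw [← Matrix.mulVec_mulVec, projMatrix_mulVec_of_sum_eq_zero hΔ, ← Matrix.mulVec_mulVec,
    Matrix.dotProduct_mulVec, ← Matrix.mulVec_transpose, transpose_projMatrix,
    projMatrix_mulVec_of_sum_eq_zero hΔ]

lemma dotProduct_mul_inv_mul_transpose_mulVec {d k : ℕ} {p₀ Δ : Fin d → ℝ}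
    (hp₀_pos : ∀ i, 0 < p₀ i) (hp₀_sum : ∑ i, p₀ i = 1) (hΔ : ∑ i, Δ i = 0)
    {V : Matrix (Fin d) (Fin k) ℝ} (hVP : V * Vᵀ = projMatrix d)
    (hdet : IsUnit (Vᵀ * covMatrix p₀ * V).det) :
    Δ ⬝ᵥ (V * (Vᵀ * covMatrix p₀ * V)⁻¹ * Vᵀ) *ᵥ Δ = ∑ i, Δ i ^ 2 / p₀ i := by
  -- `Σ` has no inverse, but `w` solves `Σ w = Δ`, so the compressed inverse sends `Vᵀ Δ` to `Vᵀ w`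
  -- and the value is `Δ ⬝ᵥ w`.
  set w : Fin d → ℝ := fun i ↦ Δ i / p₀ i with hw
  have hcov : covMatrix p₀ *ᵥ w = Δ := by
    have h : p₀ ⬝ᵥ w = 0 := by
      rw [← hΔ]
      exact Finset.sum_congr rfl fun i _ ↦ mul_div_cancel₀ _ (hp₀_pos i).ne'
    rw [covMatrix, Matrix.sub_mulVec, Matrix.vecMulVec_mulVec, h]
    ext i
    simp [Matrix.mulVec_diagonal, hw, mul_div_cancel₀ _ (hp₀_pos i).ne']
  have hD : (Vᵀ * covMatrix p₀ * V) *ᵥ Vᵀ *ᵥ w = Vᵀ *ᵥ Δ := by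
    rw [Matrix.mulVec_mulVec, Matrix.mul_assoc, hVP, Matrix.mul_assoc,
      covMatrix_mul_projMatrix hp₀_sum, ← Matrix.mulVec_mulVec, hcov]
  have hDinv : (Vᵀ * covMatrix p₀ * V)⁻¹ *ᵥ Vᵀ *ᵥ Δ = Vᵀ *ᵥ w := by
    rw [← hD, Matrix.mulVec_mulVec, Matrix.nonsing_inv_mul _ hdet, Matrix.one_mulVec]
  rw [Matrix.mul_assoc, ← Matrix.mulVec_mulVec, ← Matrix.mulVec_mulVec, hDinv,
    Matrix.mulVec_mulVec, hVP, Matrix.dotProduct_mulVec, ← Matrix.mulVec_transpose,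
    transpose_projMatrix, projMatrix_mulVec_of_sum_eq_zero hΔ]
  exact Finset.sum_congr rfl fun i _ ↦ by rw [hw]; ring

/-! ### Convergence in distribution -/

lemma tendsto_law_euclideanDeviation {d : ℕ} {p₀ Δ : Fin d → ℝ}
    (hp₀_pos : ∀ i, 0 < p₀ i) (hp₀_sum : ∑ i, p₀ i = 1) (hΔ : ∑ i, Δ i = 0)
    {ρ : ℕ → ℝ} {s : ℝ} (hρ : ∀ᶠ n in atTop, 0 < ρ n)
    (hs : Tendsto (fun n : ℕ ↦ 1 / ((n : ℝ) * ρ n)) atTop (nhds s))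
    {Ω : ℕ → Type*} [∀ n, MeasurableSpace (Ω n)]
    {μ : ∀ n, Measure (Ω n)} [∀ n, IsProbabilityMeasure (μ n)]
    {X : ∀ n, Ω n → Fin d → ℕ} {Z : ∀ n, Ω n → EuclideanSpace ℝ (Fin d)}
    (hX : ∀ᶠ n in atTop, HasLaw (X n) (multinomialMeasure n (localAlternative p₀ Δ n)) (μ n))
    (hZ : ∀ᶠ n in atTop, HasLaw (Z n)
      (multivariateGaussian 0 ((1 / ρ n) • (1 : Matrix (Fin d) (Fin d) ℝ))) (μ n))
    (hXZ : ∀ᶠ n in atTop, IndepFun (X n) (Z n) (μ n))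
    {Q : ℕ → ProbabilityMeasure (EuclideanSpace ℝ (Fin d))}
    (hQ : ∀ n, (Q n : Measure _) = (μ n).map fun ω ↦ euclideanDeviation p₀ n (X n ω) (Z n ω))
    {Q' : ProbabilityMeasure (EuclideanSpace ℝ (Fin d))}
    (hQ' : ∀ t : EuclideanSpace ℝ (Fin d), charFun (Q' : Measure _) t = Complex.exp
      (inner ℝ (WithLp.toLp 2 Δ) t * Complex.I -
        ((t ⬝ᵥ (covMatrix p₀ + s • (1 : Matrix (Fin d) (Fin d) ℝ)) *ᵥ t : ℝ) : ℂ) / 2)) :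
    Tendsto Q atTop (nhds Q') := by
  rw [ProbabilityMeasure.tendsto_iff_tendsto_charFun]
  intro t
  set m := ∑ j, p₀ j * t j with hm
  have ha : ∑ i, p₀ i * (t i - m) = 0 := by
    simp only [mul_sub]
    rw [Finset.sum_sub_distrib, ← Finset.sum_mul, hp₀_sum, one_mul, ← hm, sub_self]
  have h1 := tendsto_sum_localAlternative_mul_exp_pow hp₀_sum hΔ ha
  have h2 : Tendsto (fun n : ℕ ↦
      Complex.exp (-((1 / ((n : ℝ) * ρ n) * ∑ i, t i ^ 2 : ℝ) : ℂ) / 2)) atTop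
      (nhds (Complex.exp (-((s * ∑ i, t i ^ 2 : ℝ) : ℂ) / 2))) := by
    have hc : Continuous fun x : ℝ ↦ Complex.exp (-((x * ∑ i, t i ^ 2 : ℝ) : ℂ) / 2) := by
      fun_prop
    exact (hc.tendsto s).comp hs
  have hpos : ∀ᶠ n in atTop, ∀ i, 0 ≤ localAlternative p₀ Δ n i := by
    refine eventually_all.2 fun i ↦ ?_
    have h0 : Tendsto (fun n : ℕ ↦ Δ i / √(n : ℝ)) atTop (nhds 0) :=
      tendsto_const_nhds.div_atTop (Real.tendsto_sqrt_atTop.comp tendsto_natCast_atTop_atTop)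
    have h3 : Tendsto (fun n : ℕ ↦ localAlternative p₀ Δ n i) atTop (nhds (p₀ i)) := by
      simpa [localAlternative] using h0.const_add (p₀ i)
    exact (h3.eventually_const_lt (hp₀_pos i)).mono fun _ h ↦ h.le
  have hlim := h1.mul h2
  have hval : Complex.exp ((∑ i, Δ i * (t i - m) : ℝ) * Complex.I -
        (∑ i, p₀ i * (t i - m) ^ 2 : ℝ) / 2) *
      Complex.exp (-((s * ∑ i, t i ^ 2 : ℝ) : ℂ) / 2) = charFun (Q' : Measure _) t := by
    rw [hQ', ← Complex.exp_add]
    have hΔm : ∑ i, Δ i * (t i - m) = inner ℝ (WithLp.toLp 2 Δ) t := by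
      simp only [mul_sub, PiLp.inner_apply]
      rw [Finset.sum_sub_distrib, ← Finset.sum_mul, hΔ, zero_mul, sub_zero]
      exact Finset.sum_congr rfl fun i _ ↦ by simp [mul_comm]
    have hquad : t ⬝ᵥ (covMatrix p₀ + s • (1 : Matrix (Fin d) (Fin d) ℝ)) *ᵥ t =
        ∑ i, p₀ i * (t i - m) ^ 2 + s * ∑ i, t i ^ 2 :=
      dotProduct_covMatrix_add_smul_mulVec hp₀_sum s t
    rw [hΔm, hquad]
    congr 1
    push_cast
    ring
  rw [← hval]
  refine hlim.congr' ?_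
  filter_upwards [hρ, hX, hZ, hXZ, hpos, eventually_ge_atTop 1] with n hρn hXn hZn hXZn hp hn
  rw [hQ, charFun_map_euclideanDeviation hn hp hXn (one_div_nonneg.2 hρn.le) hZn hXZn, div_div,
    mul_comm (ρ n)]

/-- Covers all three limits: `V = 1` with `s > 0`, and `V` orthogonal to the all-ones vector with `s
> 0` or `s = 0`. -/
lemma tendstoInDistribution_quadraticForm {d k : ℕ} {p₀ Δ : Fin d → ℝ}
    (hp₀_pos : ∀ i, 0 < p₀ i) (hp₀_sum : ∑ i, p₀ i = 1) (hΔ : ∑ i, Δ i = 0)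
    {ρ : ℕ → ℝ} {s : ℝ} (hs0 : 0 ≤ s) (hρ : ∀ᶠ n in atTop, 0 < ρ n)
    (hs : Tendsto (fun n : ℕ ↦ 1 / ((n : ℝ) * ρ n)) atTop (nhds s))
    {Ω : ℕ → Type*} [∀ n, MeasurableSpace (Ω n)]
    {μ : ∀ n, Measure (Ω n)} [∀ n, IsProbabilityMeasure (μ n)]
    {X : ∀ n, Ω n → Fin d → ℕ} {Z : ∀ n, Ω n → EuclideanSpace ℝ (Fin d)}
    (hX_meas : ∀ n, AEMeasurable (X n) (μ n)) (hZ_meas : ∀ n, AEMeasurable (Z n) (μ n))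
    (hX : ∀ᶠ n in atTop, HasLaw (X n) (multinomialMeasure n (localAlternative p₀ Δ n)) (μ n))
    (hZ : ∀ᶠ n in atTop, HasLaw (Z n)
      (multivariateGaussian 0 ((1 / ρ n) • (1 : Matrix (Fin d) (Fin d) ℝ))) (μ n))
    (hXZ : ∀ᶠ n in atTop, IndepFun (X n) (Z n) (μ n))
    {V : Matrix (Fin d) (Fin k) ℝ} (hV : Vᵀ * V = 1) (hsV : 0 < s ∨ 1 ᵥ* V = 0)
    {M : ℕ → Matrix (Fin d) (Fin d) ℝ}
    (hM : ∀ᶠ n : ℕ in atTop, M n = V * (Vᵀ * privCovMatrix p₀ (n * ρ n) * V)⁻¹ * Vᵀ)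
    {lam : ℝ} (hlam : lam =
      Δ ⬝ᵥ (V * (Vᵀ * (covMatrix p₀ + s • (1 : Matrix (Fin d) (Fin d) ℝ)) * V)⁻¹ * Vᵀ) *ᵥ Δ) :
    TendstoInDistribution (fun n ω ↦ noisyDeviation p₀ n (X n ω) (Z n ω) ⬝ᵥ
      M n *ᵥ noisyDeviation p₀ n (X n ω) (Z n ω)) atTop id μ (noncentralChiSquare k lam) := by
  subst hlam
  have hD := posDef_transpose_mul_covMatrix_mul hp₀_pos hp₀_sum hs0 hV hsV
  have hS := posSemidef_covMatrix_add_smul hp₀_pos hp₀_sum hs0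
  have hdet : IsUnit (Vᵀ * (covMatrix p₀ + s • (1 : Matrix (Fin d) (Fin d) ℝ)) * V).det :=
    (Matrix.isUnit_iff_isUnit_det _).1 hD.isUnit
  have hU (n : ℕ) := aemeasurable_euclideanDeviation p₀ n (hX_meas n) (hZ_meas n)
  let Q : ℕ → ProbabilityMeasure (EuclideanSpace ℝ (Fin d)) := fun n ↦
    ⟨(μ n).map fun ω ↦ euclideanDeviation p₀ n (X n ω) (Z n ω),
      Measure.isProbabilityMeasure_map (hU n)⟩
  let Q' : ProbabilityMeasure (EuclideanSpace ℝ (Fin d)) :=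
    ⟨multivariateGaussian (WithLp.toLp 2 Δ) (covMatrix p₀ + s • 1), inferInstance⟩
  have hQ' (t : EuclideanSpace ℝ (Fin d)) : charFun (Q' : Measure _) t = Complex.exp
      (inner ℝ (WithLp.toLp 2 Δ) t * Complex.I -
        ((t ⬝ᵥ (covMatrix p₀ + s • (1 : Matrix (Fin d) (Fin d) ℝ)) *ᵥ t : ℝ) : ℂ) / 2) := by
    rw [real_inner_comm]
    exact charFun_multivariateGaussian hS t
  have hQ : Tendsto Q atTop (nhds Q') :=
    tendsto_law_euclideanDeviation hp₀_pos hp₀_sum hΔ hρ hs hX hZ hXZ (fun _ ↦ rfl) hQ'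
  -- Matrix inversion is continuous at the limiting compression because its determinant is nonzero,
  -- also when `s = 0`.
  have hMlim : Tendsto M atTop (nhds
      (V * (Vᵀ * (covMatrix p₀ + s • (1 : Matrix (Fin d) (Fin d) ℝ)) * V)⁻¹ * Vᵀ)) := by
    have hc : Continuous fun x : ℝ ↦
        Vᵀ * (covMatrix p₀ + x • (1 : Matrix (Fin d) (Fin d) ℝ)) * V := by fun_prop
    have hinv : ContinuousAt Inv.inv
        (Vᵀ * (covMatrix p₀ + s • (1 : Matrix (Fin d) (Fin d) ℝ)) * V) := by
      apply continuousAt_matrix_inv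
      rw [Ring.inverse_eq_inv']
      exact continuousAt_inv₀ hdet.ne_zero
    have hc2 : Continuous fun A : Matrix (Fin k) (Fin k) ℝ ↦ V * A * Vᵀ := by fun_prop
    refine ((hc2.tendsto _).comp (hinv.tendsto.comp ((hc.tendsto s).comp hs))).congr' ?_
    filter_upwards [hM] with n hn
    rw [hn]
    rfl
  have hmeas (A : Matrix (Fin d) (Fin d) ℝ) (n : ℕ) :
      AEMeasurable (fun ω ↦ noisyDeviation p₀ n (X n ω) (Z n ω) ⬝ᵥ
        A *ᵥ noisyDeviation p₀ n (X n ω) (Z n ω)) (μ n) :=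
    (measurable_quadraticForm A).comp_aemeasurable (hU n)
  refine ⟨fun n ↦ hmeas (M n) n, aemeasurable_id, ?_⟩
  have key := tendsto_map_quadraticForm hQ hMlim
  refine Tendsto.congr (fun n ↦ Subtype.ext ?_)
    (key.mono_right (le_of_eq (congrArg nhds (Subtype.ext ?_))))
  · change ((μ n).map _).map _ = (μ n).map _
    rw [AEMeasurable.map_map_of_aemeasurable (measurable_quadraticForm _).aemeasurable (hU n)]
    rfl
  · change (Q' : Measure (EuclideanSpace ℝ (Fin d))).map _ = (noncentralChiSquare k _).map id
    rw [Measure.map_id]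
    exact map_quadraticForm_eq_noncentralChiSquare (Q' : Measure (EuclideanSpace ℝ (Fin d)))
      (WithLp.toLp 2 Δ) _ V hD hQ'

lemma privCovMatrix_posDef {d : ℕ} {p₀ : Fin d → ℝ} (hp₀_pos : ∀ i, 0 < p₀ i)
    (hp₀_sum : ∑ i, p₀ i = 1) {r : ℝ} (hr : 0 < r) : (privCovMatrix p₀ r).PosDef := by
  have h : 0 < 1 / r := one_div_pos.2 hr
  simpa [privCovMatrix] using posDef_transpose_mul_covMatrix_mul hp₀_pos hp₀_sum h.le
    (V := (1 : Matrix (Fin d) (Fin d) ℝ)) (by simp) (.inl h)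

lemma mul_inv_privCovMatrix_mul_transpose {d k : ℕ} {p₀ : Fin d → ℝ} (hp₀_pos : ∀ i, 0 < p₀ i)
    (hp₀_sum : ∑ i, p₀ i = 1) {r : ℝ} (hr : 0 < r) {V : Matrix (Fin d) (Fin k) ℝ}
    (hV : Vᵀ * V = 1) (hVP : V * Vᵀ = projMatrix d) :
    V * (Vᵀ * privCovMatrix p₀ r * V)⁻¹ * Vᵀ =
      projMatrix d * (privCovMatrix p₀ r)⁻¹ * projMatrix d := by
  refine mul_inv_mul_transpose_eq hV hVP
    ((Matrix.isUnit_iff_isUnit_det _).1 (privCovMatrix_posDef hp₀_pos hp₀_sum hr).isUnit) ?_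
  simp [privCovMatrix, Matrix.add_mul, Matrix.mul_add, covMatrix_mul_projMatrix hp₀_sum,
    projMatrix_mul_covMatrix hp₀_sum]

end PrivateChiSquare

end

open PrivateChiSquare in
theorem mainTheorem7 {d : ℕ} (p₀ Δ : Fin d → ℝ)
    (hp₀_pos : ∀ i, 0 < p₀ i) (hp₀_sum : ∑ i, p₀ i = 1) (hΔ : ∑ i, Δ i = 0)
    (ρ : ℕ → ℝ)
    {Ω : ℕ → Type*} [∀ n, MeasurableSpace (Ω n)]
    (μ : ∀ n, Measure (Ω n)) [∀ n, IsProbabilityMeasure (μ n)]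
    (X : ∀ n, Ω n → Fin d → ℕ) (Z : ∀ n, Ω n → EuclideanSpace ℝ (Fin d))
    (hX_meas : ∀ n, AEMeasurable (X n) (μ n)) (hZ_meas : ∀ n, AEMeasurable (Z n) (μ n))
    (hX : ∀ᶠ n in atTop, HasLaw (X n) (multinomialMeasure n (localAlternative p₀ Δ n)) (μ n))
    (hZ : ∀ᶠ n in atTop, HasLaw (Z n)
      (multivariateGaussian 0 ((1 / ρ n) • (1 : Matrix (Fin d) (Fin d) ℝ))) (μ n))
    (hXZ : ∀ᶠ n in atTop, IndepFun (X n) (Z n) (μ n)) :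
    (∀ r : ℝ, 0 < r → Tendsto (fun n : ℕ ↦ (n : ℝ) * ρ n) atTop (nhds r) →
      TendstoInDistribution (fun n ω ↦ unprojectedStat p₀ n (ρ n) (X n ω) (Z n ω)) atTop id μ
        (noncentralChiSquare d (Δ ⬝ᵥ (privCovMatrix p₀ r)⁻¹ *ᵥ Δ)) ∧
      TendstoInDistribution (fun n ω ↦ projectedStat p₀ n (ρ n) (X n ω) (Z n ω)) atTop id μ
        (noncentralChiSquare (d - 1) (Δ ⬝ᵥ (privCovMatrix p₀ r)⁻¹ *ᵥ Δ))) ∧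
    (Tendsto (fun n : ℕ ↦ (n : ℝ) * ρ n) atTop atTop →
      TendstoInDistribution (fun n ω ↦ projectedStat p₀ n (ρ n) (X n ω) (Z n ω)) atTop id μ
        (noncentralChiSquare (d - 1) (∑ i, Δ i ^ 2 / p₀ i))) := by
  obtain _ | k := d
  -- For `d = 0` the empty sum cannot equal `1`.
  · simp at hp₀_sum
  obtain ⟨V, hV, hVP⟩ := exists_isometry_mul_transpose_eq_projMatrix k
  have h1V := one_vecMul_eq_zero hV hVP
  have hM (hpos : ∀ᶠ n : ℕ in atTop, 0 < (n : ℝ) * ρ n) : ∀ᶠ n : ℕ in atTop,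
      projMatrix (k + 1) * (privCovMatrix p₀ (n * ρ n))⁻¹ * projMatrix (k + 1) =
        V * (Vᵀ * privCovMatrix p₀ (n * ρ n) * V)⁻¹ * Vᵀ :=
    hpos.mono fun n hn ↦
      (mul_inv_privCovMatrix_mul_transpose hp₀_pos hp₀_sum hn hV hVP).symm
  have hρ (hpos : ∀ᶠ n : ℕ in atTop, 0 < (n : ℝ) * ρ n) : ∀ᶠ n in atTop, 0 < ρ n :=
    hpos.mono fun n hn ↦ pos_of_mul_pos_right hn n.cast_nonneg
  refine ⟨fun r hr hnr ↦ ?_, fun hn ↦ ?_⟩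
  · have hpos := hnr.eventually_const_lt hr
    have hs : Tendsto (fun n : ℕ ↦ 1 / ((n : ℝ) * ρ n)) atTop (nhds (1 / r)) :=
      tendsto_const_nhds.div hnr hr.ne'
    have hr' : 0 < 1 / r := one_div_pos.2 hr
    refine ⟨?_, ?_⟩
    · exact tendstoInDistribution_quadraticForm hp₀_pos hp₀_sum hΔ hr'.le (hρ hpos) hs hX_meas
        hZ_meas hX hZ hXZ (V := 1) (by simp) (.inl hr') (.of_forall fun n ↦ by simp)
        (by simp [privCovMatrix])
    · refine tendstoInDistribution_quadraticForm hp₀_pos hp₀_sum hΔ hr'.le (hρ hpos) hs hX_meas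
        hZ_meas hX hZ hXZ hV (.inl hr') (hM hpos) ?_
      rw [← dotProduct_mul_mul_projMatrix hΔ,
        ← mul_inv_privCovMatrix_mul_transpose hp₀_pos hp₀_sum hr hV hVP, privCovMatrix]
  · have hpos := hn.eventually_gt_atTop 0
    have hs : Tendsto (fun n : ℕ ↦ 1 / ((n : ℝ) * ρ n)) atTop (nhds 0) :=
      tendsto_const_nhds.div_atTop hn
    refine tendstoInDistribution_quadraticForm hp₀_pos hp₀_sum hΔ le_rfl (hρ hpos) hs hX_meas
        hZ_meas hX hZ hXZ hV (.inr h1V) (hM hpos) ?_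
    have hD := posDef_transpose_mul_covMatrix_mul hp₀_pos hp₀_sum le_rfl hV (.inr h1V)
    rw [zero_smul, add_zero] at hD ⊢
    exact (dotProduct_mul_inv_mul_transpose_mulVec hp₀_pos hp₀_sum hΔ hVP
      ((Matrix.isUnit_iff_isUnit_det _).1 hD.isUnit)).symm
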